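/- A group $G$ has \emph{local retractions} if for every finitely generated subgroup $H\le G$ there are a finite-index subgroup $K\le G$ containing $H$ and a homomorphism $\rho\colon K\to H$ with $\rho|_H=\mathrm{id}_H$. Let $\mathcal{LR}$ be the class of finitely presented groups with local retractions. Then $\mathcal{LR}$ is uniformly effectively coherent, that is: (1) every $G\in\mathcal{LR}$ is coherent: $G$ is finitely generated and each finitely generated subgroup of $G$ is finitely presented; (2) there is an algorithm (one partial recursive function) that, given as input any finite presentation $P=\langle x_1,\dots,x_n\mid r_1,\dots,r_k\rangle$ of a group $G\in\mathcal{LR}$ and any finite list $S=(s_1,\dots,s_m)$ of elements of $G$, written as words in $x_1^{\pm1},\dots,x_n^{\pm1}$, halts and outputs a finite presentation $Q=\langle y_1,\dots,y_m\mid q_1,\dots,q_l\rangle$ of the subgroup $\langle S\rangle\le G$, in which the generator $y_i$ represents $s_i$; that is, $y_i\mapsto s_i$ defines an isomorphism from the group presented by $Q$ onto $\langle S\rangle$. The algorithm is only required to work on inputs for which the group presented by $P$ has local retractions. -/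

import Mathlib

universe u

/-- `G` has local retractions: every finitely generated subgroup `H` is a retract of some
finite-index subgroup `K`, i.e. the inclusion `H ↪ K` has a left inverse `ρ : K → H`. -/
def HasLocalRetractions (G : Type u) [Group G] : Prop :=
  ∀ H : Subgroup G, H.FG →
    ∃ K : Subgroup G, K.FiniteIndex ∧
      ∃ hHK : H ≤ K, ∃ ρ : K →* H, ρ.comp (Subgroup.inclusion hHK) = MonoidHom.id H

/-- The class of finitely presented groups with local retractions. -/
def IsLR (G : Type u) [Group G] : Prop :=
  Group.IsFinitelyPresented G ∧ HasLocalRetractions G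

/-- A finitely generated group is coherent if all its finitely generated subgroups are finitely
presented. -/
def IsCoherentGroup (G : Type u) [Group G] : Prop :=
  Group.FG G ∧ ∀ H : Subgroup G, H.FG → Group.IsFinitelyPresented H

/-- Words in the letters `x₀, x₁, …` and their inverses; `(i, true)` stands for `xᵢ` and
`(i, false)` for `xᵢ⁻¹`. -/
abbrev GWord : Type := List (ℕ × Bool)

/-- The word uses only the letters `x₀, …, xₙ₋₁` and their inverses. -/
def GWord.InLetters (n : ℕ) (w : GWord) : Prop :=
  ∀ p ∈ w, p.1 < n

/-- The element of the free group on `x₀, …, xₙ₋₁` that a word represents.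
(Letters `xᵢ` with `i ≥ n` are sent to `1`; they do not occur in words with `InLetters n`.) -/
def GWord.toFree (n : ℕ) (w : GWord) : FreeGroup (Fin n) :=
  FreeGroup.lift (fun i : ℕ => if h : i < n then FreeGroup.of (⟨i, h⟩ : Fin n) else 1)
    (FreeGroup.mk w)

/-- Finite presentations as finite data: the number `n` of generators `x₀, …, xₙ₋₁`, and a finite
list of relators. -/
abbrev FinPres : Type := ℕ × List GWord

namespace FinPres

/-- The number of generators. -/
abbrev gens (P : FinPres) : ℕ := P.1

/-- The list of relators. -/
abbrev relators (P : FinPres) : List GWord := P.2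

/-- All relators are words in the generators `x₀, …, xₙ₋₁`. -/
def WellFormed (P : FinPres) : Prop :=
  ∀ r ∈ P.relators, GWord.InLetters P.gens r

/-- The group `⟨x₀, …, xₙ₋₁ ∣ relators⟩`. -/
abbrev Grp (P : FinPres) : Type :=
  PresentedGroup {g : FreeGroup (Fin P.gens) | ∃ r ∈ P.relators, g = GWord.toFree P.gens r}

/-- The element of the presented group that a word represents. -/
def elt (P : FinPres) (w : GWord) : P.Grp :=
  PresentedGroup.mk _ (GWord.toFree P.gens w)

end FinPres

/-- A class `C` of groups is uniformly effectively coherent: its members are coherent, and there is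
one algorithm (a partial recursive function `f`) which, whenever it is given a finite presentation
`P` of a group `G` in `C` and a finite list `S` of elements of `G`, written as words in the
generators of `P`, halts and outputs a finite presentation `Q` of the subgroup of `G` generated
by `S`. The generators of `Q` are matched with the given elements: the `i`-th generator of `Q`
represents the `i`-th element of `S`. Nothing is required of `f` on other inputs. -/
def UniformlyEffectivelyCoherent (C : (G : Type u) → [Group G] → Prop) : Prop :=
  (∀ (G : Type u) [Group G], C G → IsCoherentGroup G) ∧
  ∃ f : FinPres × List GWord →. FinPres, Partrec f ∧
    ∀ (G : Type u) [Group G], C G →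
      ∀ P : FinPres, P.WellFormed → ∀ e : P.Grp ≃* G,
        ∀ S : List GWord, (∀ w ∈ S, GWord.InLetters P.gens w) →
          ∃ Q ∈ f (P, S), Q.WellFormed ∧ Q.gens = S.length ∧
            ∃ φ : Q.Grp ≃* Subgroup.closure {g : G | ∃ w ∈ S, g = e (P.elt w)},
              ∀ (i : ℕ) (hQ : i < Q.gens) (hS : i < S.length),
                (φ (PresentedGroup.of ⟨i, hQ⟩) : G) = e (P.elt S[i])

/-! Let `S` generate `H`, and let `ρ` retract a finite-index subgroup `K ≥ H` onto `H`. The action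
on `G ⧸ K` has the Schreier cocycle `k u x = t(ux)⁻¹ u t(x)` in `K`. Applying `ρ` to it labels every
move of a letter by an element of `H`, written as a word in `S`. In the resulting finite table
relators fix all points with trivial label, and each `s_j` fixes the base point with label `s_j`
(`exists_of_retraction`).

Conversely, take any finite table in which the loops fix all points and the words of `S` fix `0`.
Let `Q` have generators `y_j` and relators saying that loops have trivial label and that `s_j` has
label `y_j` at `0`. The group of `P` acts on `ℕ × Q` with `s_j (0, q) = (0, y_j q)`. If the relators
of `Q` hold for the `s_j`, then `y_j ↦ s_j` is a homomorphism. It is injective: `w(s) = 1` gives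
`(0, 1) = w(s) (0, 1) = (0, w(y))` (`Closed.exists_injective`).

Closedness of a table is a finite check, and validity of the relators is witnessed by products of
conjugates of relators of `P`. The algorithm searches for a table with such witnesses. Every hit is
correct, and the retraction guarantees a hit; `K` and `ρ` are never computed. -/

/-! ### Words: evaluation, substitution, products of conjugates -/

namespace GWord

/-- The value of a word at a family of group elements. -/
def eval {G : Type*} [Group G] (g : ℕ → G) (w : GWord) : G :=
  (w.map fun x => cond x.2 (g x.1) (g x.1)⁻¹).prod

section eval

variable {G : Type*} [Group G] (g : ℕ → G)

theorem eval_eq_lift (w : GWord) : eval g w = FreeGroup.lift g (FreeGroup.mk w) := by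
  simp [eval, FreeGroup.lift_mk]

@[simp] theorem eval_nil : eval g [] = 1 := rfl

@[simp] theorem eval_append (v w : GWord) : eval g (v ++ w) = eval g v * eval g w := by
  simp [eval]

theorem eval_cons (x : ℕ × Bool) (w : GWord) : eval g (x :: w) = eval g [x] * eval g w :=
  eval_append g [x] w

@[simp] theorem eval_pos (i : ℕ) : eval g [(i, true)] = g i := by simp [eval]

@[simp] theorem eval_neg (i : ℕ) : eval g [(i, false)] = (g i)⁻¹ := by simp [eval]

@[simp] theorem eval_invRev (w : GWord) : eval g (FreeGroup.invRev w) = (eval g w)⁻¹ := by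
  rw [eval_eq_lift, ← FreeGroup.inv_mk, map_inv, eval_eq_lift]

theorem map_eval {H : Type*} [Group H] (f : G →* H) (w : GWord) :
    f (eval g w) = eval (fun i => f (g i)) w := by
  simp only [eval_eq_lift]
  refine DFunLike.congr_fun (f := f.comp (FreeGroup.lift g)) ?_ _
  ext
  simp

theorem eval_congr {g h : ℕ → G} {n : ℕ} {w : GWord} (hw : w.InLetters n)
    (hgh : ∀ i < n, g i = h i) : eval g w = eval h w := by
  unfold eval
  congr 1
  refine List.map_congr_left fun x hx => ?_
  rw [hgh _ (hw x hx)]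

theorem exists_eval_of_mem_closure {x : G} (hx : x ∈ Subgroup.closure (Set.range g)) :
    ∃ w, eval g w = x := by
  induction hx using Subgroup.closure_induction with
  | mem x hx =>
    obtain ⟨i, rfl⟩ := hx
    exact ⟨[(i, true)], by simp⟩
  | one => exact ⟨[], rfl⟩
  | mul x y _ _ hx hy =>
    obtain ⟨v, rfl⟩ := hx
    obtain ⟨w, rfl⟩ := hy
    exact ⟨v ++ w, by simp⟩
  | inv x _ hx =>
    obtain ⟨v, rfl⟩ := hx
    exact ⟨FreeGroup.invRev v, by simp⟩

end eval

/-- Delete all letters other than `x₀, …, xₙ₋₁`. -/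
def restrict (n : ℕ) (w : GWord) : GWord :=
  w.flatMap fun x => if x.1 < n then [x] else []

theorem restrict_inLetters (n : ℕ) (w : GWord) : (restrict n w).InLetters n := by
  intro p hp
  obtain ⟨x, -, hx⟩ := List.mem_flatMap.1 hp
  split_ifs at hx with h
  · rw [List.mem_singleton.1 hx]; exact h
  · simp at hx

theorem eval_restrict {G : Type*} [Group G] {g : ℕ → G} {n : ℕ} (hg : ∀ i, n ≤ i → g i = 1)
    (w : GWord) : eval g (restrict n w) = eval g w := by
  induction w with
  | nil => rfl
  | cons x w ih =>
    rw [eval_cons, ← ih, restrict, List.flatMap_cons, eval_append]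
    congr 1
    split_ifs with h
    · rfl
    · simp [eval, hg _ (not_lt.1 h)]

/-- Substitute the words of a list for the letters of a word. -/
def subst (S : List GWord) (w : GWord) : GWord :=
  w.flatMap fun x => cond x.2 (S.getD x.1 []) (FreeGroup.invRev (S.getD x.1 []))

theorem eval_subst {G : Type*} [Group G] (g : ℕ → G) (S : List GWord) (w : GWord) :
    eval g (subst S w) = eval (fun j => eval g (S.getD j [])) w := by
  induction w with
  | nil => rfl
  | cons x w ih =>
    rw [eval_cons, ← ih, subst, List.flatMap_cons, eval_append]
    congr 1
    obtain ⟨i, b⟩ := x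
    cases b
    · rw [eval_neg, ← eval_invRev]; rfl
    · rw [eval_pos]; rfl

theorem subst_inLetters {n : ℕ} {S : List GWord} (hS : ∀ w ∈ S, GWord.InLetters n w) (w : GWord) :
    (subst S w).InLetters n := by
  have key : ∀ i, ∀ p ∈ S.getD i [], p.1 < n := by
    intro i p hp
    rw [List.getD_eq_getElem?_getD] at hp
    rcases h : S[i]? with _ | v
    · simp [h] at hp
    · rw [h] at hp
      exact hS v (List.mem_of_getElem? h) p hp
  intro p hp
  obtain ⟨⟨i, b⟩, -, hx⟩ := List.mem_flatMap.1 hp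
  cases b
  · simp only [cond_false, FreeGroup.invRev, List.mem_reverse, List.mem_map] at hx
    obtain ⟨q, hq, rfl⟩ := hx
    exact key i q hq
  · exact key i p hx

/-- A product of conjugates of words of `R` and their inverses, listed by `D`. -/
def derived (R : List GWord) (D : List (GWord × ℕ × Bool)) : GWord :=
  D.flatMap fun d => d.1 ++ ((cond d.2.2 (R.getD d.2.1 []) (FreeGroup.invRev (R.getD d.2.1 []))) ++
    FreeGroup.invRev d.1)

theorem eval_derived {G : Type*} [Group G] {g : ℕ → G} {R : List GWord}
    (hR : ∀ r ∈ R, eval g r = 1) (D : List (GWord × ℕ × Bool)) : eval g (derived R D) = 1 := by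
  have key : ∀ i : ℕ, eval g (R[i]?.getD []) = 1 := by
    intro i
    rcases h : R[i]? with _ | v
    · rfl
    · exact hR v (List.mem_of_getElem? h)
  induction D with
  | nil => rfl
  | cons d D ih =>
    rw [derived, List.flatMap_cons, eval_append, ← derived, ih]
    obtain ⟨v, i, b⟩ := d
    cases b <;> simp [key]

theorem eval_eq_of_reduce_eq {G : Type*} [Group G] (g : ℕ → G) {v w : GWord}
    (h : FreeGroup.reduce v = FreeGroup.reduce w) : eval g v = eval g w := by
  rw [eval_eq_lift, eval_eq_lift, FreeGroup.reduce.exact h]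

theorem derived_append (R : List GWord) (C D : List (GWord × ℕ × Bool)) :
    derived R (C ++ D) = derived R C ++ derived R D := List.flatMap_append

/-- Inverting a product of conjugates reverses the list and flips the exponents; the conjugators
stay. -/
theorem mk_derived_reverse (R : List GWord) (D : List (GWord × ℕ × Bool)) :
    FreeGroup.mk (derived R (D.map fun d => (d.1, d.2.1, !d.2.2)).reverse) =
      (FreeGroup.mk (derived R D))⁻¹ := by
  induction D with
  | nil => rfl
  | cons d D ih =>
    obtain ⟨v, i, b⟩ := d
    change _ = (FreeGroup.mk (derived R ([(v, i, b)] ++ D)))⁻¹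
    rw [List.map_cons, List.reverse_cons, derived_append, ← FreeGroup.mul_mk, ih, derived_append,
      ← FreeGroup.mul_mk, mul_inv_rev]
    congr 1
    cases b <;> simp [derived, ← FreeGroup.mul_mk, ← FreeGroup.inv_mk, mul_assoc]

theorem exists_derived_of_mem_normalClosure {R : List GWord} {x : FreeGroup ℕ}
    (hx : x ∈ Subgroup.normalClosure {y | ∃ r ∈ R, y = FreeGroup.mk r}) :
    ∃ D, FreeGroup.mk (derived R D) = x := by
  rw [Subgroup.normalClosure] at hx
  induction hx using Subgroup.closure_induction with
  | mem x hx =>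
    obtain ⟨_, ⟨r, hr, rfl⟩, hc⟩ := Group.mem_conjugatesOfSet_iff.1 hx
    obtain ⟨c, rfl⟩ := isConj_iff.1 hc
    obtain ⟨i, hi⟩ := List.mem_iff_getElem?.1 hr
    refine ⟨[(c.toWord, i, true)], ?_⟩
    simp [derived, hi, ← FreeGroup.mul_mk, ← FreeGroup.inv_mk, FreeGroup.mk_toWord, mul_assoc]
  | one => exact ⟨[], rfl⟩
  | mul x y _ _ hx hy =>
    obtain ⟨C, rfl⟩ := hx
    obtain ⟨D, rfl⟩ := hy
    exact ⟨C ++ D, by rw [derived_append, ← FreeGroup.mul_mk]⟩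
  | inv x _ hx =>
    obtain ⟨D, rfl⟩ := hx
    exact ⟨_, mk_derived_reverse R D⟩

end GWord

/-! ### Groups given by finite presentations -/

namespace FinPres

variable (P : FinPres)

/-- The generators of the presented group, continued by `1`. -/
def gen (i : ℕ) : P.Grp := if h : i < P.gens then PresentedGroup.of ⟨i, h⟩ else 1

theorem gen_of_lt {i : ℕ} (h : i < P.gens) : P.gen i = PresentedGroup.of ⟨i, h⟩ := dif_pos h

theorem gen_of_le {i : ℕ} (h : P.gens ≤ i) : P.gen i = 1 := dif_neg (not_lt.2 h)

theorem toFree_eq_eval (n : ℕ) (w : GWord) : GWord.toFree n w =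
    GWord.eval (fun i : ℕ => if h : i < n then FreeGroup.of (⟨i, h⟩ : Fin n) else 1) w := by
  rw [GWord.toFree, GWord.eval_eq_lift]

theorem elt_eq_eval (w : GWord) : P.elt w = GWord.eval P.gen w := by
  rw [elt, toFree_eq_eval, GWord.map_eval]
  congr 1
  funext i
  rw [gen]
  split_ifs
  · rfl
  · exact map_one _

theorem eval_relator {r : GWord} (hr : r ∈ P.relators) : GWord.eval P.gen r = 1 := by
  rw [← elt_eq_eval]
  exact PresentedGroup.one_of_mem ⟨r, hr, rfl⟩

/-- Von Dyck's theorem for words with letters indexed by `ℕ`. -/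
theorem exists_hom {G : Type*} [Group G] (g : ℕ → G) (hg : ∀ i, P.gens ≤ i → g i = 1)
    (hr : ∀ r ∈ P.relators, GWord.eval g r = 1) :
    ∃ f : P.Grp →* G, ∀ w, f (GWord.eval P.gen w) = GWord.eval g w := by
  have key : ∀ w, FreeGroup.lift (fun i : Fin P.gens => g i) (GWord.toFree P.gens w) =
      GWord.eval g w := by
    intro w
    rw [toFree_eq_eval, GWord.map_eval]
    congr 1
    funext i
    split_ifs with h
    · simp
    · rw [map_one, hg i (not_lt.1 h)]
  refine ⟨PresentedGroup.toGroup (f := fun i : Fin P.gens => g i) ?_, fun w => ?_⟩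
  · rintro _ ⟨r, h, rfl⟩
    rw [key, hr r h]
  · rw [← elt_eq_eval, ← key]
    rfl

theorem exists_eval_eq (x : P.Grp) : ∃ w, GWord.eval P.gen w = x := by
  apply GWord.exists_eval_of_mem_closure
  have := PresentedGroup.closure_range_of
    {g : FreeGroup (Fin P.gens) | ∃ r ∈ P.relators, g = GWord.toFree P.gens r}
  have h : x ∈ (⊤ : Subgroup P.Grp) := trivial
  rw [← this] at h
  refine Subgroup.closure_mono ?_ h
  rintro _ ⟨i, rfl⟩
  exact ⟨i, P.gen_of_lt i.2⟩

theorem map_toFree {n : ℕ} {w : GWord} (hw : w.InLetters n) :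
    FreeGroup.map Fin.val (GWord.toFree n w) = FreeGroup.mk w := by
  rw [toFree_eq_eval, GWord.map_eval,
    GWord.eval_congr (h := FreeGroup.of) hw (fun i hi => by simp [hi]), GWord.eval_eq_lift]
  exact DFunLike.congr_fun (FreeGroup.lift_of_eq_id ℕ) _

/-- Makes triviality of a word semi-decidable. The normal closure is moved along `Fin.val` into the
free group on `ℕ`; this loses no letters because relators and `w` use only the first `P.gens` of
them. -/
theorem exists_derived {P : FinPres} (hP : P.WellFormed) {w : GWord} (hw : w.InLetters P.gens)
    (h : GWord.eval P.gen w = 1) :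
    ∃ D, FreeGroup.reduce (GWord.derived P.relators D) = FreeGroup.reduce w := by
  rw [← elt_eq_eval, elt, PresentedGroup.mk_eq_one_iff] at h
  have hle : Subgroup.normalClosure
      {g : FreeGroup (Fin P.gens) | ∃ r ∈ P.relators, g = GWord.toFree P.gens r} ≤
      (Subgroup.normalClosure {y | ∃ r ∈ P.relators, y = FreeGroup.mk r}).comap
        (FreeGroup.map Fin.val) := by
    refine Subgroup.normalClosure_le_normal ?_
    rintro _ ⟨r, hr, rfl⟩
    exact Subgroup.subset_normalClosure ⟨r, hr, map_toFree (hP r hr)⟩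
  have := hle h
  rw [Subgroup.mem_comap, map_toFree hw] at this
  obtain ⟨D, hD⟩ := GWord.exists_derived_of_mem_normalClosure this
  exact ⟨D, FreeGroup.reduce.sound hD⟩

end FinPres

/-! ### Labelled tables and the presentations they define -/

/-- A finite table which prescribes, for a letter `x` and a point `a`, the image of `a` under `x`
and a word labelling this move. Points outside the table are fixed, with empty label. -/
abbrev LabelledTable : Type := List (ℕ × GWord)

namespace LabelledTable

/-- The move of the point `a` under the letter `x`. -/
def step (L : LabelledTable) (x : ℕ × Bool) (a : ℕ) : ℕ × GWord :=
  -- The entry for `(x, a)` sits at the position given by its code.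
  (L[Encodable.encode (x, a)]?).getD (a, [])

/-- The move of the point `a` under a word, whose letters act from right to left. -/
def run (L : LabelledTable) (w : GWord) (a : ℕ) : ℕ × GWord :=
  w.foldr (fun x s => ((L.step x s.1).1, (L.step x s.1).2 ++ s.2)) (a, [])

@[simp] theorem run_nil (L : LabelledTable) (a : ℕ) : L.run [] a = (a, []) := rfl

theorem run_cons (L : LabelledTable) (x : ℕ × Bool) (w : GWord) (a : ℕ) :
    L.run (x :: w) a =
      ((L.step x (L.run w a).1).1, (L.step x (L.run w a).1).2 ++ (L.run w a).2) := rfl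

/-- The code of a pair is at least its second component. Hence only points below `L.length` can
move, and closedness is a finite check. -/
theorem step_of_length_le (L : LabelledTable) (x : ℕ × Bool) {a : ℕ} (ha : L.length ≤ a) :
    L.step x a = (a, []) := by
  have : L.length ≤ Encodable.encode (x, a) := ha.trans (Nat.right_le_pair _ _)
  rw [step, List.getElem?_eq_none this, Option.getD_none]

theorem run_eq_self {L : LabelledTable} {w : GWord} {a : ℕ}
    (h : ∀ x ∈ w, L.step x a = (a, [])) : L.run w a = (a, []) := by
  induction w with
  | nil => rfl
  | cons x w ih =>
    rw [run_cons, ih fun y hy => h y (List.mem_cons_of_mem _ hy)]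
    simp [h x List.mem_cons_self]

/-- The words that have to act trivially: the relators of `P` and the products of a generator and
its inverse. -/
def loops (P : FinPres) : List GWord :=
  P.relators ++ (List.range P.gens).flatMap fun i =>
    [[(i, true), (i, false)], [(i, false), (i, true)]]

/-- All pairs of a loop and a point of the table. -/
def basedLoops (L : LabelledTable) (P : FinPres) : List (GWord × ℕ) :=
  (loops P).flatMap fun r => (List.range L.length).map fun a => (r, a)

/-- All loops fix all points, and the words of `S` fix the point `0`. -/
def Closed (L : LabelledTable) (P : FinPres) (S : List GWord) : Prop :=
  ((L.basedLoops P).map fun x => (L.run x.1 x.2).1) = (L.basedLoops P).map Prod.snd ∧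
    (S.map fun s => (L.run s 0).1) = S.map fun _ => 0

/-- The labels of the loops, and the relators which identify the label of the `j`-th word of `S`
with the `j`-th generator. -/
def labelRelators (L : LabelledTable) (P : FinPres) (S : List GWord) : List GWord :=
  ((L.basedLoops P).map fun x => (L.run x.1 x.2).2) ++
    (List.range S.length).map fun j => (L.run (S.getD j []) 0).2 ++ [(j, false)]

/-- The presentation on generators corresponding to the words of `S` defined by a table. -/
def pres (L : LabelledTable) (P : FinPres) (S : List GWord) : FinPres :=
  -- Labels may contain letters beyond `S.length`. These count as trivial, in agreement with the
  -- empty default word of `S.getD`.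
  (S.length, (L.labelRelators P S).map (GWord.restrict S.length))

theorem pres_wellFormed (L : LabelledTable) (P : FinPres) (S : List GWord) :
    (L.pres P S).WellFormed := by
  intro r hr
  obtain ⟨w, -, rfl⟩ := List.mem_map.1 hr
  exact GWord.restrict_inLetters _ _

theorem eval_labelRelators {L : LabelledTable} {P : FinPres} {S : List GWord} {w : GWord}
    (hw : w ∈ L.labelRelators P S) : GWord.eval (L.pres P S).gen w = 1 := by
  rw [← GWord.eval_restrict (n := S.length) (fun i hi => FinPres.gen_of_le _ hi)]
  exact FinPres.eval_relator _ (List.mem_map_of_mem hw)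

theorem mem_basedLoops {L : LabelledTable} {P : FinPres} {r : GWord} {a : ℕ} :
    (r, a) ∈ L.basedLoops P ↔ r ∈ loops P ∧ a < L.length := by
  simp [basedLoops]

variable {L : LabelledTable} {P : FinPres} {S : List GWord}

theorem Closed.run_loop (h : L.Closed P S) {r : GWord} (hr : r ∈ loops P) (a : ℕ) :
    (L.run r a).1 = a ∧ GWord.eval (L.pres P S).gen (L.run r a).2 = 1 := by
  rcases lt_or_ge a L.length with ha | ha
  · have hm : (r, a) ∈ L.basedLoops P := mem_basedLoops.2 ⟨hr, ha⟩
    refine ⟨List.map_inj_left.1 h.1 _ hm, eval_labelRelators ?_⟩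
    exact List.mem_append_left _ (List.mem_map_of_mem (f := fun x => (L.run x.1 x.2).2) hm)
  · rw [run_eq_self fun x _ => L.step_of_length_le x ha]
    exact ⟨rfl, rfl⟩

theorem Closed.run_generator (h : L.Closed P S) {j : ℕ} (hj : j < S.length) :
    (L.run (S.getD j []) 0).1 = 0 ∧
      GWord.eval (L.pres P S).gen (L.run (S.getD j []) 0).2 = (L.pres P S).gen j := by
  have hS : S.getD j [] = S[j] := by simp [hj]
  refine ⟨?_, ?_⟩
  · rw [hS]
    exact List.map_inj_left.1 h.2 _ (List.getElem_mem hj)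
  · have : (L.run (S.getD j []) 0).2 ++ [(j, false)] ∈ L.labelRelators P S :=
      List.mem_append_right _ (List.mem_map.2 ⟨j, List.mem_range.2 hj, rfl⟩)
    have := eval_labelRelators this
    rwa [GWord.eval_append, GWord.eval_neg, mul_inv_eq_one] at this

/-- The move of a pair of a point and a group element under a word. -/
def act {Q : Type*} [Group Q] (y : ℕ → Q) (L : LabelledTable) (w : GWord) (p : ℕ × Q) : ℕ × Q :=
  ((L.run w p.1).1, GWord.eval y (L.run w p.1).2 * p.2)

theorem act_cons {Q : Type*} [Group Q] (y : ℕ → Q) (L : LabelledTable) (x : ℕ × Bool) (w : GWord)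
    (p : ℕ × Q) : act y L (x :: w) p = act y L [x] (act y L w p) := by
  simp [act, run_cons, mul_assoc]

theorem Closed.act_loop (h : L.Closed P S) {r : GWord} (hr : r ∈ loops P)
    (p : ℕ × (L.pres P S).Grp) : act (L.pres P S).gen L r p = p := by
  obtain ⟨h1, h2⟩ := h.run_loop hr p.1
  rw [act, h1, h2, one_mul]

theorem pos_neg_mem_loops {i : ℕ} (hi : i < P.gens) : [(i, true), (i, false)] ∈ loops P := by
  simp [loops, hi]

theorem neg_pos_mem_loops {i : ℕ} (hi : i < P.gens) : [(i, false), (i, true)] ∈ loops P := by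
  simp [loops, hi]

/-- A closed table defines an action of the presented group. -/
theorem Closed.exists_action (h : L.Closed P S) (hP : P.WellFormed) :
    ∃ f : P.Grp →* Equiv.Perm (ℕ × (L.pres P S).Grp), ∀ w : GWord, w.InLetters P.gens →
      ⇑(f (GWord.eval P.gen w)) = act (L.pres P S).gen L w := by
  -- The inverse letter supplies the inverse permutation; for this the words `x x⁻¹` and `x⁻¹ x` are
  -- among the loops.
  let σ : ℕ → Equiv.Perm (ℕ × (L.pres P S).Grp) := fun i =>
    if hi : i < P.gens then
      { toFun := act (L.pres P S).gen L [(i, true)]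
        invFun := act (L.pres P S).gen L [(i, false)]
        left_inv := fun p => by
          rw [← act_cons, h.act_loop (neg_pos_mem_loops hi)]
        right_inv := fun p => by
          rw [← act_cons, h.act_loop (pos_neg_mem_loops hi)] }
    else 1
  have key : ∀ w : GWord, w.InLetters P.gens →
      ⇑(GWord.eval σ w) = act (L.pres P S).gen L w := by
    intro w hw
    induction w with
    | nil => funext p; simp [act]
    | cons x w ih =>
      funext p
      rw [GWord.eval_cons, act_cons, Equiv.Perm.mul_apply,
        ih fun y hy => hw y (List.mem_cons_of_mem _ hy)]
      obtain ⟨i, b⟩ := x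
      have hi : i < P.gens := hw (i, b) List.mem_cons_self
      cases b
      · simp only [GWord.eval_neg, σ, dif_pos hi]; rfl
      · simp only [GWord.eval_pos, σ, dif_pos hi]; rfl
  obtain ⟨f, hf⟩ := P.exists_hom σ (fun i hi => dif_neg (not_lt.2 hi)) (by
    intro r hr
    ext1 p
    rw [key r (hP r hr), h.act_loop (List.mem_append_left _ hr)]
    rfl)
  exact ⟨f, fun w hw => by rw [hf, key w hw]⟩

/-- If the relators of a closed table hold for the words of `S`, then the table presents the
subgroup generated by these words. -/
theorem Closed.exists_injective (h : L.Closed P S) (hP : P.WellFormed)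
    (hS : ∀ w ∈ S, GWord.InLetters P.gens w)
    (hrel : ∀ w ∈ L.labelRelators P S, GWord.eval P.gen (GWord.subst S w) = 1) :
    ∃ f : (L.pres P S).Grp →* P.Grp, Function.Injective f ∧
      ∀ w, f (GWord.eval (L.pres P S).gen w) = GWord.eval P.gen (GWord.subst S w) := by
  have hone : ∀ i, (L.pres P S).gens ≤ i → GWord.eval P.gen (S.getD i []) = 1 := by
    intro i hi
    have : S.getD i [] = [] := List.getD_eq_default _ _ hi
    rw [this, GWord.eval_nil]
  obtain ⟨f, hf⟩ := (L.pres P S).exists_hom (fun j => GWord.eval P.gen (S.getD j [])) hone (by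
    intro r hr
    obtain ⟨w, hw, rfl⟩ := List.mem_map.1 hr
    rw [GWord.eval_restrict (n := S.length) hone, ← GWord.eval_subst, hrel w hw])
  refine ⟨f, ?_, fun w => by rw [hf, GWord.eval_subst]⟩
  obtain ⟨Φ, hΦ⟩ := h.exists_action hP
  -- On the fibre over `0` the subgroup generated by `S` acts through left multiplication by the new
  -- generators.
  have pos : ∀ j q, Φ (GWord.eval P.gen (S.getD j [])) (0, q) = (0, (L.pres P S).gen j * q) := by
    intro j q
    rcases lt_or_ge j S.length with hj | hj
    · have hSj : S.getD j [] = S[j] := by simp [hj]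
      obtain ⟨h1, h2⟩ := h.run_generator hj
      rw [hΦ _ (by rw [hSj]; exact hS _ (List.getElem_mem hj)), act, h1, h2]
    · rw [hone j hj, FinPres.gen_of_le _ hj]
      simp
  have key : ∀ w q, Φ (GWord.eval (fun j => GWord.eval P.gen (S.getD j [])) w) (0, q) =
      (0, GWord.eval (L.pres P S).gen w * q) := by
    intro w
    induction w with
    | nil => simp
    | cons x w ih =>
      intro q
      rw [GWord.eval_cons, map_mul, Equiv.Perm.mul_apply, ih, GWord.eval_cons _ x w, mul_assoc]
      obtain ⟨i, b⟩ := x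
      cases b
      · rw [GWord.eval_neg, GWord.eval_neg, map_inv, Equiv.Perm.inv_eq_iff_eq, pos,
          mul_inv_cancel_left]
      · rw [GWord.eval_pos, GWord.eval_pos, pos]
  -- If `w` is trivial on `S`, it fixes `(0, 1)`; by `key` it also sends it to `(0, w(y))`, so `w(y)
  -- = 1`.
  rw [injective_iff_map_eq_one]
  intro q hq
  obtain ⟨w, rfl⟩ := FinPres.exists_eval_eq _ q
  rw [hf] at hq
  have := key w 1
  rw [hq] at this
  simpa using (congrArg Prod.snd this).symm

end LabelledTable

/-! ### Tables from retractions -/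

namespace LabelledTable

/-- Any labelled move on finitely many letters and points is given by a table. -/
theorem exists_step_eq (n N : ℕ) (τ : ℕ × Bool → ℕ → ℕ × GWord)
    (hτ : ∀ x a, N ≤ a → τ x a = (a, [])) :
    ∃ L : LabelledTable, (∀ x a, x.1 < n → a < N → L.step x a = τ x a) ∧
      ∀ x a, N ≤ a → L.step x a = (a, []) := by
  obtain ⟨M, hM⟩ := Finset.exists_nat_subset_range
    (((Finset.range n ×ˢ (Finset.univ : Finset Bool)) ×ˢ Finset.range N).image Encodable.encode)
  -- The filler `(0, [])` at numbers that code no pair is never read by `step`.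
  let L : LabelledTable := (List.range M).map fun c =>
    ((Encodable.decode c : Option ((ℕ × Bool) × ℕ)).map fun p => τ p.1 p.2).getD (0, [])
  have hL : ∀ x a, Encodable.encode (x, a) < M → L.step x a = τ x a := by
    intro x a h
    rw [step, List.getElem?_map, List.getElem?_range h, Option.map_some, Option.getD_some,
      Encodable.encodek, Option.map_some, Option.getD_some]
  refine ⟨L, fun x a hx ha => hL x a ?_, fun x a ha => ?_⟩
  · refine Finset.mem_range.1 (hM (Finset.mem_image_of_mem _ ?_))
    simp [hx, ha]
  · by_cases h : Encodable.encode (x, a) < M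
    · rw [hL x a h, hτ x a ha]
    · have : L.length ≤ Encodable.encode (x, a) := by simpa [L] using h
      rw [step, List.getElem?_eq_none this, Option.getD_none]

/-- A retraction of a finite-index subgroup onto a subgroup `H` gives a table whose labels
represent elements of `H`. -/
theorem exists_of_retraction {G : Type*} [Group G] (g s : ℕ → G) (n : ℕ) {H K : Subgroup G}
    [K.FiniteIndex] (hHK : H ≤ K) (ρ : K →* H)
    (hρ : ρ.comp (Subgroup.inclusion hHK) = MonoidHom.id H)
    (hs : ∀ x ∈ H, ∃ w, GWord.eval s w = x) :
    ∃ L : LabelledTable,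
      (∀ r : GWord, r.InLetters n → GWord.eval g r = 1 →
        ∀ a, (L.run r a).1 = a ∧ GWord.eval s (L.run r a).2 = 1) ∧
      ∀ r : GWord, r.InLetters n → GWord.eval g r ∈ H →
        (L.run r 0).1 = 0 ∧ GWord.eval s (L.run r 0).2 = GWord.eval g r := by
  classical
  obtain ⟨N, ⟨E₀⟩⟩ := Finite.exists_equiv_fin (G ⧸ K)
  have hN : 0 < N := (E₀ (QuotientGroup.mk 1)).pos
  -- The swap gives the trivial coset the number `0`, the base point at which the words of `S` are
  -- run.
  let E : G ⧸ K ≃ Fin N := E₀.trans (Equiv.swap (E₀ (QuotientGroup.mk 1)) ⟨0, hN⟩)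
  have hE : E (QuotientGroup.mk 1) = ⟨0, hN⟩ := by simp [E]
  -- The representative `1` of the trivial coset makes the cocycle of `h ∈ H` there equal to `h`
  -- itself.
  let t : G ⧸ K → G := fun x => if x = QuotientGroup.mk 1 then 1 else x.out
  have ht : ∀ x, (QuotientGroup.mk (t x) : G ⧸ K) = x := by
    intro x
    by_cases h : x = QuotientGroup.mk 1
    · simp [t, h]
    · simp only [t, if_neg h, QuotientGroup.out_eq']
  have hmem : ∀ (u : G) (x : G ⧸ K), (t (u • x))⁻¹ * (u * t x) ∈ K := by
    intro u x
    rw [← QuotientGroup.eq, ht]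
    conv_lhs => rw [← ht x]
    rfl
  let k : G → G ⧸ K → K := fun u x => ⟨(t (u • x))⁻¹ * (u * t x), hmem u x⟩
  -- The cocycle identity; it makes the labels along a word multiply to the image under `ρ` of the
  -- cocycle of the whole word.
  have k_mul : ∀ u v x, k (u * v) x = k u (v • x) * k v x := by
    intro u v x
    ext
    simp [k, mul_smul, mul_assoc]
  have k_one : ∀ x, k 1 x = 1 := by
    intro x
    ext
    simp [k]
  choose W hW using fun x : H => hs x x.2
  let τ : ℕ × Bool → ℕ → ℕ × GWord := fun x a =>
    if h : a < N then
      ((E (GWord.eval g [x] • E.symm ⟨a, h⟩) : ℕ),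
        W (ρ (k (GWord.eval g [x]) (E.symm ⟨a, h⟩))))
    else (a, [])
  obtain ⟨L, hL, hL'⟩ := exists_step_eq n N τ fun x a h => dif_neg (not_lt.2 h)
  have run_eq : ∀ r : GWord, r.InLetters n → ∀ y : G ⧸ K,
      (L.run r (E y)).1 = E (GWord.eval g r • y) ∧
        GWord.eval s (L.run r (E y)).2 = ρ (k (GWord.eval g r) y) := by
    intro r hr y
    induction r with
    | nil => simp [k_one]
    | cons x r ih =>
      obtain ⟨h1, h2⟩ := ih fun z hz => hr z (List.mem_cons_of_mem _ hz)
      have hstep : L.step x (E (GWord.eval g r • y)) =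
          ((E (GWord.eval g [x] • GWord.eval g r • y) : ℕ),
            W (ρ (k (GWord.eval g [x]) (GWord.eval g r • y)))) := by
        rw [hL x _ (hr x List.mem_cons_self) (Fin.is_lt _)]
        simp only [τ, Fin.is_lt, dif_pos, Fin.eta, Equiv.symm_apply_apply]
      rw [run_cons, h1, hstep, GWord.eval_append, hW, h2, GWord.eval_cons g x r, mul_smul, k_mul,
        map_mul]
      exact ⟨rfl, rfl⟩
  refine ⟨L, fun r hr h a => ?_, fun r hr h => ?_⟩
  · rcases lt_or_ge a N with ha | ha
    · obtain ⟨h1, h2⟩ := run_eq r hr (E.symm ⟨a, ha⟩)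
      simp only [Equiv.apply_symm_apply, h, one_smul, k_one, map_one] at h1 h2
      exact ⟨h1, h2⟩
    · rw [run_eq_self fun x _ => hL' x a ha]
      exact ⟨rfl, rfl⟩
  · obtain ⟨h1, h2⟩ := run_eq r hr (QuotientGroup.mk 1)
    have hfix : GWord.eval g r • (QuotientGroup.mk 1 : G ⧸ K) = QuotientGroup.mk 1 := by
      change (QuotientGroup.mk (GWord.eval g r * 1) : G ⧸ K) = _
      rw [mul_one, eq_comm, QuotientGroup.eq]
      simpa using hHK h
    -- An element of `H` fixes the trivial coset, so its label there is its image under `ρ`, which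
    -- is the element itself.
    have hk : k (GWord.eval g r) (QuotientGroup.mk 1) = Subgroup.inclusion hHK ⟨_, h⟩ := by
      ext
      simp only [k, hfix]
      simp [t]
    have hρ' := DFunLike.congr_fun hρ ⟨_, h⟩
    rw [MonoidHom.comp_apply] at hρ'
    rw [hfix, hE] at h1
    rw [hE, hk, hρ'] at h2
    exact ⟨h1, h2⟩

theorem loops_inLetters {P : FinPres} (hP : P.WellFormed) {r : GWord} (hr : r ∈ loops P) :
    r.InLetters P.gens := by
  rcases List.mem_append.1 hr with hr | hr
  · exact hP r hr
  · obtain ⟨i, hi, hr⟩ := List.mem_flatMap.1 hr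
    have hi := List.mem_range.1 hi
    rcases List.mem_pair.1 hr with rfl | rfl <;> intro p hp <;>
      rcases List.mem_pair.1 hp with rfl | rfl <;> exact hi

theorem eval_loops {P : FinPres} {r : GWord} (hr : r ∈ loops P) : GWord.eval P.gen r = 1 := by
  rcases List.mem_append.1 hr with hr | hr
  · exact P.eval_relator hr
  · obtain ⟨i, -, hr⟩ := List.mem_flatMap.1 hr
    rcases List.mem_pair.1 hr with rfl | rfl <;> rw [GWord.eval_cons] <;> simp

/-- In a group with local retractions, every finite list of words has a closed table whose relators
hold for these words. -/
theorem exists_closed {P : FinPres} (hP : P.WellFormed) (hG : HasLocalRetractions P.Grp)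
    {S : List GWord} (hS : ∀ w ∈ S, GWord.InLetters P.gens w) :
    ∃ L : LabelledTable, L.Closed P S ∧
      ∀ w ∈ L.labelRelators P S, GWord.eval P.gen (GWord.subst S w) = 1 := by
  let s : ℕ → P.Grp := fun j => GWord.eval P.gen (S.getD j [])
  have hfg : (Subgroup.closure (Set.range s)).FG := by
    rw [Subgroup.fg_iff]
    -- The index `S.length` is included to account for the default value `1`, taken by all later
    -- indices.
    refine ⟨_, rfl, ((Set.finite_Iic S.length).image s).subset ?_⟩
    rintro _ ⟨j, rfl⟩
    rcases le_or_gt j S.length with hj | hj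
    · exact ⟨j, hj, rfl⟩
    · refine ⟨S.length, Set.mem_Iic.2 le_rfl, ?_⟩
      simp [s, hj.le]
  obtain ⟨K, hK, hHK, ρ, hρ⟩ := hG _ hfg
  obtain ⟨L, hL1, hL2⟩ := exists_of_retraction P.gen s P.gens hHK ρ hρ
    fun x hx => GWord.exists_eval_of_mem_closure s hx
  have hSs : ∀ j, ∀ hj : j < S.length, GWord.eval P.gen S[j] = s j := by
    intro j hj
    simp [s, hj]
  have hmem : ∀ j, s j ∈ Subgroup.closure (Set.range s) := fun j =>
    Subgroup.subset_closure ⟨j, rfl⟩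
  refine ⟨L, ⟨?_, ?_⟩, ?_⟩
  · refine List.map_inj_left.2 ?_
    rintro ⟨r, a⟩ hra
    obtain ⟨hr, -⟩ := mem_basedLoops.1 hra
    exact (hL1 r (loops_inLetters hP hr) (eval_loops hr) a).1
  · refine List.map_inj_left.2 fun w hw => ?_
    obtain ⟨j, hj, rfl⟩ := List.mem_iff_getElem.1 hw
    exact (hL2 _ (hS _ hw) (hSs j hj ▸ hmem j)).1
  · intro w hw
    rw [GWord.eval_subst]
    rcases List.mem_append.1 hw with hw | hw
    · obtain ⟨⟨r, a⟩, hra, rfl⟩ := List.mem_map.1 hw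
      obtain ⟨hr, -⟩ := mem_basedLoops.1 hra
      exact (hL1 r (loops_inLetters hP hr) (eval_loops hr) a).2
    · obtain ⟨j, hj, rfl⟩ := List.mem_map.1 hw
      have hj := List.mem_range.1 hj
      have hSj : S.getD j [] = S[j] := by simp [hj]
      have := (hL2 S[j] (hS _ (List.getElem_mem hj)) (hSs j hj ▸ hmem j)).2
      rw [hSj, GWord.eval_append, GWord.eval_neg, mul_inv_eq_one, this, hSs j hj]

end LabelledTable

/-! ### Primitive recursiveness of the constructions -/

namespace Primrec

variable {α : Type*} [Primcodable α]

/-- Free reduction is a right fold: each letter is cancelled against, or put before, the head of the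
reduced tail. -/
theorem freeGroup_reduce : Primrec (FreeGroup.reduce : GWord → GWord) := by
  have hstep : Primrec₂ fun (_ : GWord) (p : (ℕ × Bool) × GWord) =>
      (List.casesOn p.2 [p.1] fun hd tl =>
        if p.1.1 = hd.1 ∧ p.1.2 = not hd.2 then tl else p.1 :: hd :: tl : GWord) := by
    refine Primrec.list_casesOn (σ := GWord) (f := fun q : GWord × (ℕ × Bool) × GWord => q.2.2)
      (g := fun q => [q.2.1])
      (h := fun q r => if q.2.1.1 = r.1.1 ∧ q.2.1.2 = not r.1.2 then r.2 else q.2.1 :: r.1 :: r.2)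
      (snd.comp snd) (list_cons.comp (fst.comp snd) (const [])) ?_
    have hx : Primrec fun z : (GWord × (ℕ × Bool) × GWord) × (ℕ × Bool) × GWord => z.1.2.1 :=
      fst.comp (snd.comp fst)
    have hy : Primrec fun z : (GWord × (ℕ × Bool) × GWord) × (ℕ × Bool) × GWord => z.2.1 :=
      fst.comp snd
    have ht : Primrec fun z : (GWord × (ℕ × Bool) × GWord) × (ℕ × Bool) × GWord => z.2.2 :=
      snd.comp snd
    refine Primrec.ite (PrimrecPred.and ?_ ?_) ht (list_cons.comp hx (list_cons.comp hy ht))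
    · exact Primrec.eq.comp (fst.comp hx) (fst.comp hy)
    · exact Primrec.eq.comp (snd.comp hx) (Primrec.not.comp (snd.comp hy))
  refine (list_foldr .id (const []) hstep).of_eq fun w => ?_
  induction w with
  | nil => rfl
  | cons x w ih =>
    rw [FreeGroup.reduce.cons, ← ih]
    rfl

theorem freeGroup_invRev : Primrec (FreeGroup.invRev : GWord → GWord) :=
  list_reverse.comp (list_map .id
    (pair (fst.comp snd) (Primrec.not.comp (snd.comp snd))).to₂)

theorem gword_restrict {n : α → ℕ} {w : α → GWord} (hn : Primrec n) (hw : Primrec w) :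
    Primrec fun a => GWord.restrict (n a) (w a) :=
  list_flatMap hw (Primrec.ite (nat_lt.comp (fst.comp snd) (hn.comp fst))
    (list_cons.comp snd (const [])) (const [])).to₂

theorem gword_subst {S : α → List GWord} {w : α → GWord} (hS : Primrec S) (hw : Primrec w) :
    Primrec fun a => GWord.subst (S a) (w a) := by
  have hget : Primrec fun p : α × ℕ × Bool => (S p.1).getD p.2.1 [] :=
    (list_getD []).comp (hS.comp fst) (fst.comp snd)
  exact list_flatMap hw (Primrec.cond (snd.comp snd) hget (freeGroup_invRev.comp hget)).to₂

theorem gword_derived {R : α → List GWord} {D : α → List (GWord × ℕ × Bool)} (hR : Primrec R)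
    (hD : Primrec D) : Primrec fun a => GWord.derived (R a) (D a) := by
  have hget : Primrec fun p : α × GWord × ℕ × Bool => (R p.1).getD p.2.2.1 [] :=
    (list_getD []).comp (hR.comp fst) (fst.comp (snd.comp snd))
  exact list_flatMap hD (list_append.comp (fst.comp snd) (list_append.comp
    (Primrec.cond (snd.comp (snd.comp snd)) hget (freeGroup_invRev.comp hget))
    (freeGroup_invRev.comp (fst.comp snd)))).to₂

theorem labelledTable_step {L : α → LabelledTable} {x : α → ℕ × Bool} {a : α → ℕ}
    (hL : Primrec L) (hx : Primrec x) (ha : Primrec a) :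
    Primrec fun z => (L z).step (x z) (a z) :=
  option_getD.comp (list_getElem?.comp hL (Primrec.encode.comp (pair hx ha)))
    (pair ha (const []))

theorem labelledTable_run {L : α → LabelledTable} {w : α → GWord} {a : α → ℕ}
    (hL : Primrec L) (hw : Primrec w) (ha : Primrec a) :
    Primrec fun z => (L z).run (w z) (a z) := by
  have hstep : Primrec fun p : α × (ℕ × Bool) × ℕ × GWord => (L p.1).step p.2.1 p.2.2.1 :=
    labelledTable_step (hL.comp fst) (fst.comp snd) (fst.comp (snd.comp snd))
  exact list_foldr hw (pair ha (const [])) (pair (fst.comp hstep)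
    (list_append.comp (snd.comp hstep) (snd.comp (snd.comp snd)))).to₂

theorem labelledTable_loops : Primrec LabelledTable.loops := by
  have hlet : ∀ b : Bool, Primrec fun p : FinPres × ℕ => (p.2, b) := fun b =>
    pair snd (const b)
  have hword : ∀ b c : Bool, Primrec fun p : FinPres × ℕ => [(p.2, b), (p.2, c)] := fun b c =>
    list_cons.comp (hlet b) (list_cons.comp (hlet c) (const []))
  exact list_append.comp snd (list_flatMap (list_range.comp fst)
    (list_cons.comp (hword true false) (list_cons.comp (hword false true) (const []))).to₂)

theorem labelledTable_basedLoops {L : α → LabelledTable} {P : α → FinPres}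
    (hL : Primrec L) (hP : Primrec P) : Primrec fun a => (L a).basedLoops (P a) :=
  list_flatMap (labelledTable_loops.comp hP)
    (list_map (list_range.comp (list_length.comp (hL.comp fst)))
      (pair (snd.comp fst) snd).to₂).to₂

theorem labelledTable_closed {L : α → LabelledTable} {P : α → FinPres} {S : α → List GWord}
    (hL : Primrec L) (hP : Primrec P) (hS : Primrec S) :
    PrimrecPred fun a => (L a).Closed (P a) (S a) := by
  have hB := labelledTable_basedLoops hL hP
  refine PrimrecPred.and (Primrec.eq.comp (list_map hB ?_) (list_map hB (snd.comp snd).to₂))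
    (Primrec.eq.comp (list_map hS ?_) (list_map hS (const 0).to₂))
  · exact (fst.comp (labelledTable_run (hL.comp fst) (fst.comp snd) (snd.comp snd))).to₂
  · exact (fst.comp (labelledTable_run (hL.comp fst) snd (const 0))).to₂

theorem labelledTable_labelRelators {L : α → LabelledTable} {P : α → FinPres}
    {S : α → List GWord} (hL : Primrec L) (hP : Primrec P) (hS : Primrec S) :
    Primrec fun a => (L a).labelRelators (P a) (S a) := by
  refine list_append.comp (list_map (labelledTable_basedLoops hL hP) ?_)
    (list_map (list_range.comp (list_length.comp hS)) ?_)
  · exact (snd.comp (labelledTable_run (hL.comp fst) (fst.comp snd) (snd.comp snd))).to₂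
  · exact (list_append.comp (snd.comp (labelledTable_run (hL.comp fst)
      ((list_getD []).comp (hS.comp fst) snd) (const 0)))
      (list_cons.comp (pair snd (const false)) (const []))).to₂

theorem labelledTable_pres {L : α → LabelledTable} {P : α → FinPres}
    {S : α → List GWord} (hL : Primrec L) (hP : Primrec P) (hS : Primrec S) :
    Primrec fun a => (L a).pres (P a) (S a) :=
  pair (list_length.comp hS) (list_map (labelledTable_labelRelators hL hP hS)
    (gword_restrict (list_length.comp (hS.comp fst)) snd).to₂)

end Primrec

/-! ### Certificates and the search for them -/

/-- A table together with derivations of its relators. -/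
abbrev RetractCertificate : Type := LabelledTable × List (List (GWord × ℕ × Bool))

/-- The table is closed, and the derivations show that its relators hold for the words of `S`. -/
def RetractCertificate.Valid (c : RetractCertificate) (P : FinPres) (S : List GWord) : Prop :=
  c.1.Closed P S ∧
    -- Equality of the two lists pairs each relator with one derivation; comparing reduced words
    -- decides equality in the free group.
    ((c.1.labelRelators P S).map fun w => FreeGroup.reduce (GWord.subst S w)) =
      c.2.map fun D => FreeGroup.reduce (GWord.derived P.relators D)

theorem RetractCertificate.primrecPred_valid :
    PrimrecPred fun p : (FinPres × List GWord) × RetractCertificate => p.2.Valid p.1.1 p.1.2 := by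
  open Primrec in
  have hL : Primrec fun p : (FinPres × List GWord) × RetractCertificate => p.2.1 := fst.comp snd
  have hP : Primrec fun p : (FinPres × List GWord) × RetractCertificate => p.1.1 := fst.comp fst
  have hS : Primrec fun p : (FinPres × List GWord) × RetractCertificate => p.1.2 := snd.comp fst
  refine (labelledTable_closed hL hP hS).and (Primrec.eq.comp
    (list_map (labelledTable_labelRelators hL hP hS) ?_) (list_map (snd.comp snd) ?_))
  · exact (freeGroup_reduce.comp (gword_subst (hS.comp fst) snd)).to₂
  · exact (freeGroup_reduce.comp (gword_derived (snd.comp (hP.comp fst)) snd)).to₂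

open Classical in
/-- The presentation found by the certificate with a given code. -/
noncomputable def presOfCode (p : FinPres × List GWord) (k : ℕ) : Option FinPres :=
  (Encodable.decode k : Option RetractCertificate).bind fun c =>
    if c.Valid p.1 p.2 then some (c.1.pres p.1 p.2) else none

theorem primrec_presOfCode : Primrec₂ presOfCode := by
  classical
  open Primrec in
  have hpair : Primrec fun z : ((FinPres × List GWord) × ℕ) × RetractCertificate =>
      (z.1.1, z.2) := pair (fst.comp fst) snd
  have hvalid : PrimrecPred fun z : ((FinPres × List GWord) × ℕ) × RetractCertificate =>
      z.2.Valid z.1.1.1 z.1.1.2 := RetractCertificate.primrecPred_valid.comp hpair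
  have hpres : Primrec fun z : ((FinPres × List GWord) × ℕ) × RetractCertificate =>
      some (z.2.1.pres z.1.1.1 z.1.1.2) :=
    option_some.comp (labelledTable_pres (fst.comp snd) (fst.comp (fst.comp fst))
      (snd.comp (fst.comp fst)))
  have hdecode : Primrec fun z : (FinPres × List GWord) × ℕ =>
      (Encodable.decode z.2 : Option RetractCertificate) := Primrec.decode.comp snd
  exact option_bind hdecode (Primrec.ite hvalid hpres (const none)).to₂

theorem mem_presOfCode {p : FinPres × List GWord} {k : ℕ} {Q : FinPres} (h : Q ∈ presOfCode p k) :
    ∃ c : RetractCertificate, c.Valid p.1 p.2 ∧ Q = c.1.pres p.1 p.2 := by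
  obtain ⟨c, -, hc⟩ := Option.mem_bind_iff.1 h
  split_ifs at hc with hv
  · exact ⟨c, hv, (Option.mem_some.1 hc).symm⟩
  · simp at hc

theorem exists_mem_presOfCode {p : FinPres × List GWord} {c : RetractCertificate}
    (hc : c.Valid p.1 p.2) : ∃ k, ∃ Q, Q ∈ presOfCode p k :=
  ⟨Encodable.encode c, c.1.pres p.1 p.2, by
    rw [presOfCode, Encodable.encodek, Option.bind_some, if_pos hc]
    rfl⟩

/-- Termination of the search: the retraction gives the table, and relators that hold in `P.Grp`
have derivations. -/
theorem RetractCertificate.exists_valid {P : FinPres} (hP : P.WellFormed)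
    (hG : HasLocalRetractions P.Grp) {S : List GWord}
    (hS : ∀ w ∈ S, GWord.InLetters P.gens w) : ∃ c : RetractCertificate, c.Valid P S := by
  obtain ⟨L, hL, hrel⟩ := LabelledTable.exists_closed hP hG hS
  choose! D hD using fun w hw =>
    FinPres.exists_derived hP (GWord.subst_inLetters hS w) (hrel w hw)
  refine ⟨(L, (L.labelRelators P S).map D), hL, ?_⟩
  rw [List.map_map]
  exact List.map_congr_left fun w hw => (hD w hw).symm

/-- Soundness of the search: the certificate alone proves its presentation correct, whatever its
origin. -/
theorem RetractCertificate.Valid.exists_injective {c : RetractCertificate} {P : FinPres}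
    {S : List GWord} (hc : c.Valid P S) (hP : P.WellFormed)
    (hS : ∀ w ∈ S, GWord.InLetters P.gens w) :
    ∃ f : (c.1.pres P S).Grp →* P.Grp, Function.Injective f ∧
      ∀ w, f (GWord.eval (c.1.pres P S).gen w) = GWord.eval P.gen (GWord.subst S w) := by
  refine hc.1.exists_injective hP hS fun w hw => ?_
  have hm : FreeGroup.reduce (GWord.subst S w) ∈
      c.2.map fun D => FreeGroup.reduce (GWord.derived P.relators D) := by
    rw [← hc.2]
    exact List.mem_map_of_mem (f := fun w => FreeGroup.reduce (GWord.subst S w)) hw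
  obtain ⟨D, -, hD⟩ := List.mem_map.1 hm
  rw [← GWord.eval_eq_of_reduce_eq _ hD]
  exact GWord.eval_derived (fun r hr => P.eval_relator hr) D

/-- Pull back `K` and conjugate `ρ` by the isomorphism. This passes from `G` to `P.Grp`, which may
live in another universe. -/
theorem HasLocalRetractions.of_mulEquiv {G : Type*} {G' : Type*} [Group G] [Group G']
    (e : G ≃* G') (h : HasLocalRetractions G') : HasLocalRetractions G := by
  intro H hH
  have := (Group.fg_iff_subgroup_fg H).2 hH
  have hfg : Group.FG (H.map (e : G →* G')) :=
    Group.fg_of_surjective (f := (e.subgroupMap H : H →* _)) (e.subgroupMap H).surjective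
  obtain ⟨K, hK, hHK, ρ, hρ⟩ := h _ ((Group.fg_iff_subgroup_fg _).1 hfg)
  have hle : H ≤ K.comap (e : G →* G') := Subgroup.map_le_iff_le_comap.1 hHK
  refine ⟨K.comap (e : G →* G'), ⟨by
      rw [Subgroup.index_comap_of_surjective K e.surjective]
      exact hK.index_ne_zero⟩, hle,
    ((e.subgroupMap H).symm : _ →* H).comp (ρ.comp ((e : G →* G').subgroupComap K)), ?_⟩
  ext1 x
  have := DFunLike.congr_fun hρ (e.subgroupMap H x)
  change (e.subgroupMap H).symm (ρ (Subgroup.inclusion hHK (e.subgroupMap H x))) = x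
  rw [MonoidHom.comp_apply] at this
  rw [this]
  exact (e.subgroupMap H).symm_apply_apply x

/-- A valid certificate presents the subgroup generated by the given words. -/
theorem RetractCertificate.Valid.exists_mulEquiv {c : RetractCertificate} {P : FinPres}
    {S : List GWord} (hc : c.Valid P S) (hP : P.WellFormed)
    (hS : ∀ w ∈ S, GWord.InLetters P.gens w) {G : Type*} [Group G] (e : P.Grp ≃* G) :
    ∃ φ : (c.1.pres P S).Grp ≃* Subgroup.closure {g : G | ∃ w ∈ S, g = e (P.elt w)},
      ∀ (i : ℕ) (hQ : i < (c.1.pres P S).gens) (hS : i < S.length),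
        (φ (PresentedGroup.of ⟨i, hQ⟩) : G) = e (P.elt S[i]) := by
  obtain ⟨f, hinj, hf⟩ := hc.exists_injective hP hS
  let F : (c.1.pres P S).Grp →* G := (e : P.Grp →* G).comp f
  have hF : Function.Injective F := e.injective.comp hinj
  have hof : ∀ (i : ℕ) (hQ : i < (c.1.pres P S).gens) (hS : i < S.length),
      F (PresentedGroup.of ⟨i, hQ⟩) = e (P.elt S[i]) := by
    intro i hQ hS
    have := hf [(i, true)]
    rw [GWord.eval_subst, GWord.eval_pos, GWord.eval_pos, FinPres.gen_of_lt _ hQ] at this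
    change e (f _) = _
    rw [this, FinPres.elt_eq_eval]
    simp [hS]
  have hrange : F.range = Subgroup.closure {g : G | ∃ w ∈ S, g = e (P.elt w)} := by
    rw [MonoidHom.range_eq_map, ← PresentedGroup.closure_range_of, MonoidHom.map_closure]
    congr 1
    ext x
    constructor
    · rintro ⟨_, ⟨i, rfl⟩, rfl⟩
      exact ⟨S[i.1]'i.2, List.getElem_mem _, hof i.1 i.2 i.2⟩
    · rintro ⟨w, hw, rfl⟩
      obtain ⟨j, hj, rfl⟩ := List.mem_iff_getElem.1 hw
      exact ⟨_, ⟨⟨j, hj⟩, rfl⟩, hof j hj hj⟩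
  exact ⟨(MonoidHom.ofInjective hF).trans (MulEquiv.subgroupCongr hrange), hof⟩

/-! ### Abstract groups as finite data, coherence and the theorem -/

theorem FinPres.exists_mulEquiv (G : Type*) [Group G] [Group.IsFinitelyPresented G] :
    ∃ P : FinPres, P.WellFormed ∧ Nonempty (P.Grp ≃* G) := by
  obtain ⟨n, s, hs, ⟨e⟩⟩ := Group.IsFinitelyPresented.exists_mulEquiv_presentedGroup (G := G)
  let W : FreeGroup (Fin n) → GWord := fun x => x.toWord.map fun p => (p.1.val, p.2)
  have hW : ∀ x, GWord.toFree n (W x) = x := by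
    intro x
    rw [GWord.toFree, ← FreeGroup.map.mk, FreeGroup.mk_toWord]
    refine DFunLike.congr_fun (f := (FreeGroup.lift _).comp (FreeGroup.map Fin.val))
      (g := MonoidHom.id _) ?_ x
    ext
    simp
  obtain ⟨R, hRW, hR⟩ : ∃ R : List GWord, (∀ r ∈ R, ∃ x, W x = r) ∧
      s = {g | ∃ r ∈ R, g = GWord.toFree n r} := by
    refine ⟨hs.toFinset.toList.map W, fun r hr => (List.mem_map.1 hr).imp fun _ h => h.2, ?_⟩
    ext x
    simp only [List.mem_map, Finset.mem_toList, Set.Finite.mem_toFinset, Set.mem_ofPred_eq]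
    constructor
    · exact fun hx => ⟨W x, ⟨x, hx, rfl⟩, (hW x).symm⟩
    · rintro ⟨_, ⟨y, hy, rfl⟩, rfl⟩
      rwa [hW]
  subst hR
  refine ⟨(n, R), ?_, ⟨e.symm⟩⟩
  intro r hr p hp
  obtain ⟨x, rfl⟩ := hRW r hr
  obtain ⟨q, -, rfl⟩ := List.mem_map.1 hp
  exact q.1.2

theorem FinPres.exists_words (P : FinPres) {G : Type*} [Group G] (e : P.Grp ≃* G) {H : Subgroup G}
    (hH : H.FG) : ∃ S : List GWord, (∀ w ∈ S, GWord.InLetters P.gens w) ∧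
      Subgroup.closure {g : G | ∃ w ∈ S, g = e (P.elt w)} = H := by
  obtain ⟨T, rfl⟩ := hH
  choose W hW using fun x : G => P.exists_eval_eq (e.symm x)
  have hV : ∀ x, e (P.elt (GWord.restrict P.gens (W x))) = x := by
    intro x
    rw [P.elt_eq_eval, GWord.eval_restrict (fun i hi => P.gen_of_le hi), hW,
      MulEquiv.apply_symm_apply]
  refine ⟨T.toList.map fun x => GWord.restrict P.gens (W x), ?_, ?_⟩
  · intro w hw
    obtain ⟨x, -, rfl⟩ := List.mem_map.1 hw
    exact GWord.restrict_inLetters _ _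
  · congr 1
    ext x
    simp only [List.mem_map, Finset.mem_toList, Set.mem_ofPred_eq, Finset.mem_coe]
    constructor
    · rintro ⟨_, ⟨y, hy, rfl⟩, rfl⟩
      rwa [hV]
    · exact fun hx => ⟨_, ⟨x, hx, rfl⟩, (hV x).symm⟩

theorem FinPres.isFinitelyPresented (P : FinPres) : Group.IsFinitelyPresented P.Grp := by
  have hfin : {g : FreeGroup (Fin P.gens) | ∃ r ∈ P.relators, g = GWord.toFree P.gens r}.Finite :=
    ((List.finite_toSet P.relators).image (GWord.toFree P.gens)).subset
      fun g ⟨r, hr, hg⟩ => ⟨r, hr, hg.symm⟩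
  exact Group.IsFinitelyPresented.quotient _ ⟨_, hfin, rfl⟩

/-- A certificate for generators of `H` already contains a finite presentation of `H`. -/
theorem IsLR.isCoherentGroup {G : Type*} [Group G] (hG : IsLR G) : IsCoherentGroup G := by
  obtain ⟨hfp, hLR⟩ := hG
  obtain ⟨n, φ, hφ, -⟩ := hfp.out
  refine ⟨Group.fg_of_surjective hφ, fun H hH => ?_⟩
  obtain ⟨P, hP, ⟨e⟩⟩ := FinPres.exists_mulEquiv G
  obtain ⟨S, hS, rfl⟩ := P.exists_words e hH
  obtain ⟨c, hc⟩ := RetractCertificate.exists_valid hP (hLR.of_mulEquiv e) hS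
  obtain ⟨f, -⟩ := hc.exists_mulEquiv hP hS e
  have := (c.1.pres P S).isFinitelyPresented
  exact Group.IsFinitelyPresented.equiv f

theorem mainTheorem2 :
    UniformlyEffectivelyCoherent (fun (G : Type u) [Group G] => IsLR G) := by
  refine ⟨fun G _ hG => hG.isCoherentGroup, fun p => Nat.rfindOpt (presOfCode p),
    Partrec.rfindOpt primrec_presOfCode.to_comp, ?_⟩
  intro G _ hG P hP e S hS
  obtain ⟨c, hc⟩ := RetractCertificate.exists_valid hP (hG.2.of_mulEquiv e) hS
  have hdom : (Nat.rfindOpt (presOfCode (P, S))).Dom :=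
    Nat.rfindOpt_dom.2 (exists_mem_presOfCode (p := (P, S)) hc)
  obtain ⟨k, hk⟩ := Nat.rfindOpt_spec (Part.get_mem hdom)
  -- The certificate `c'` found by the search may differ from `c`, which serves only to show that
  -- the search halts.
  obtain ⟨c', hc', hQ⟩ := mem_presOfCode hk
  refine ⟨_, Part.get_mem hdom, ?_⟩
  rw [hQ]
  exact ⟨c'.1.pres_wellFormed P S, rfl, hc'.exists_mulEquiv hP hS e⟩
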